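/- Let $X$ be a smooth connected curve over $\mathbb{C}$ (projective or affine), that is, a connected separated scheme of finite type over $\mathbb{C}$, smooth of relative dimension $1$. Let $\mathfrak{E}=(E,\phi)$ be a rank $2$ Higgs bundle on $X$: a locally free sheaf $E$ of rank $2$ with an $\mathcal{O}_X$-linear morphism $\phi\colon E\to E\otimes\Omega^1_X$ (the condition $\phi\wedge\phi=0$ is automatic on a curve). Let $\pi\colon\mathbb{P}E=\mathrm{Gr}_1(E)\to X$ be the Grassmann bundle of rank one locally free quotients of $E$, with its universal exact sequence $$0\to S\xrightarrow{\ a\ }\pi^*E\xrightarrow{\ q\ }Q\to 0,$$ let $\pi^*\phi\colon\pi^*E\to\pi^*E\otimes\Omega^1_{\mathbb{P}E}$ be the pulled back Higgs field (composed with $\pi^*\Omega^1_X\to\Omega^1_{\mathbb{P}E}$), and let $b=q\otimes\mathrm{id}\colon\pi^*E\otimes\Omega^1_{\mathbb{P}E}\to Q\otimes\Omega^1_{\mathbb{P}E}$. The Higgs Grassmannian $\mathrm{Gr}_1(\mathfrak{E})$ of rank one Higgs quotients of $\mathfrak{E}$ is the closed subscheme of $\mathbb{P}E$ defined by the zero locus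 of the composition $b\circ\pi^*\phi\circ a\colon S\to Q\otimes\Omega^1_{\mathbb{P}E}$. Then $\mathrm{Gr}_1(\mathfrak{E})$ is not empty. -/

import Mathlib

open CategoryTheory AlgebraicGeometry Limits

noncomputable section

universe u

namespace HiggsGr

/-! ### Sheafification, tensor products and Kähler differentials -/

/-- The sheaf of `𝒪_X`-modules associated with a presheaf of `𝒪_X`-modules. -/
def sheafify (X : Scheme.{u}) : X.PresheafOfModules ⥤ X.Modules :=
  PresheafOfModules.sheafification (𝟙 X.ringCatSheaf.obj)

/-- Sheafification is left adjoint to the inclusion of sheaves into presheaves. -/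
def sheafifyAdj (X : Scheme.{u}) : sheafify X ⊣ Scheme.Modules.toPresheafOfModules X :=
  PresheafOfModules.sheafificationAdjunction (𝟙 X.ringCatSheaf.obj)

/-- The tensor product `M ⊗ N` of `𝒪_X`-modules: the sheaf associated with
`U ↦ Γ(M, U) ⊗ Γ(N, U)`. -/
def tensor {X : Scheme.{u}} (M N : X.Modules) : X.Modules :=
  (sheafify X).obj (PresheafOfModules.Monoidal.tensorObj (R := X.presheaf) M.val N.val)

/-- The morphism `f ⊗ g`. -/
def tensorMap {X : Scheme.{u}} {M M' N N' : X.Modules} (f : M ⟶ M') (g : N ⟶ N') :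
    tensor M N ⟶ tensor M' N' :=
  (sheafify X).map (PresheafOfModules.Monoidal.tensorHom (R := X.presheaf) f.val g.val)

/-- For a scheme `X` over `k`, the structure maps `k ⟶ Γ(X, U)`, as a morphism from the constant
presheaf `k` to `𝒪_X`. -/
def constToPresheaf {X : Scheme.{u}} {k : CommRingCat.{u}} (p : X ⟶ Spec k) :
    (Functor.const X.Opensᵒᵖ).obj k ⟶ X.presheaf where
  app U := (Scheme.ΓSpecIso k).inv ≫ p.appTop ≫ X.presheaf.map (homOfLE le_top).op
  naturality U V i := by
    simp [← Functor.map_comp]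
    rfl

/-- The presheaf of Kähler differentials `U ↦ Ω¹_{Γ(X, U) / k}`. -/
def cotangentPresheaf {X : Scheme.{u}} {k : CommRingCat.{u}} (p : X ⟶ Spec k) :
    X.PresheafOfModules :=
  PresheafOfModules.DifferentialsConstruction.relativeDifferentials' (constToPresheaf p)

/-- The cotangent sheaf `Ω¹_{X/k}`: the sheaf associated with `U ↦ Ω¹_{Γ(X, U) / k}`. -/
def cotangent {X : Scheme.{u}} {k : CommRingCat.{u}} (p : X ⟶ Spec k) : X.Modules :=
  (sheafify X).obj (cotangentPresheaf p)

/-! ### Sections `d a` and `m ⊗ n` -/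

/-- The canonical map from `Ω¹_{Γ(X, U) / k}` to the sections of the cotangent sheaf. -/
def cotangentUnit {X : Scheme.{u}} {k : CommRingCat.{u}} (p : X ⟶ Spec k) (U : X.Opens) :
    CommRingCat.KaehlerDifferential ((constToPresheaf p).app (.op U)) →ₗ[Γ(X, U)]
      Γ(cotangent p, U) :=
  (((sheafifyAdj X).unit.app (cotangentPresheaf p)).app (.op U)).hom

/-- The section `d a` of the cotangent sheaf. -/
def dSec {X : Scheme.{u}} {k : CommRingCat.{u}} (p : X ⟶ Spec k) (U : X.Opens) (a : Γ(X, U)) :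
    Γ(cotangent p, U) :=
  cotangentUnit p U (CommRingCat.KaehlerDifferential.d a)

/-- The canonical map from the tensor product of sections to the sections of the tensor
product. -/
def tensorUnit {X : Scheme.{u}} (M N : X.Modules) (U : X.Opens) :
    TensorProduct Γ(X, U) Γ(M, U) Γ(N, U) →ₗ[Γ(X, U)] Γ(tensor M N, U) :=
  (((sheafifyAdj X).unit.app
    (PresheafOfModules.Monoidal.tensorObj (R := X.presheaf) M.val N.val)).app (.op U)).hom

/-- The section `m ⊗ n` of the tensor product. -/
def tmul {X : Scheme.{u}} {M N : X.Modules} {U : X.Opens} (m : Γ(M, U)) (n : Γ(N, U)) :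
    Γ(tensor M N, U) :=
  tensorUnit M N U (TensorProduct.tmul Γ(X, U) m n)

section

variable {X Y : Scheme.{u}} {k : CommRingCat.{u}} (p : X ⟶ Spec k) {U V : X.Opens}
  {M N : X.Modules}

lemma dSec_add (a b : Γ(X, U)) : dSec p U (a + b) = dSec p U a + dSec p U b :=
  (congrArg (cotangentUnit p U)
    ((CommRingCat.KaehlerDifferential.D ((constToPresheaf p).app (.op U))).d_add a b)).trans
    (map_add _ _ _)

lemma dSec_mul (a b : Γ(X, U)) : dSec p U (a * b) = a • dSec p U b + b • dSec p U a :=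
  (congrArg (cotangentUnit p U)
    ((CommRingCat.KaehlerDifferential.D ((constToPresheaf p).app (.op U))).d_mul a b)).trans
    ((map_add _ _ _).trans (congrArg₂ (· + ·) (map_smul _ a _) (map_smul _ b _)))

lemma dSec_const (c : k) : dSec p U ((constToPresheaf p).app (.op U) c) = 0 :=
  (congrArg (cotangentUnit p U)
    ((CommRingCat.KaehlerDifferential.D ((constToPresheaf p).app (.op U))).d_map c)).trans
    (map_zero _)

lemma dSec_res (i : U ⟶ V) (a : Γ(X, V)) :
    dSec p U (X.presheaf.map i.op a) = (cotangent p).presheaf.map i.op (dSec p V a) :=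
  (congrArg (cotangentUnit p U)
    (PresheafOfModules.DifferentialsConstruction.relativeDifferentials'_map_d
      (constToPresheaf p) i.op a).symm).trans
    (PresheafOfModules.naturality_apply ((sheafifyAdj X).unit.app (cotangentPresheaf p)) i.op
      (CommRingCat.KaehlerDifferential.d (f := (constToPresheaf p).app (.op V)) a))

lemma tmul_add (m : Γ(M, U)) (n n' : Γ(N, U)) : tmul m (n + n') = tmul m n + tmul m n' :=
  (congrArg (tensorUnit M N U) (TensorProduct.tmul_add m n n')).trans (map_add _ _ _)

lemma add_tmul (m m' : Γ(M, U)) (n : Γ(N, U)) : tmul (m + m') n = tmul m n + tmul m' n :=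
  (congrArg (tensorUnit M N U) (TensorProduct.add_tmul m m' n)).trans (map_add _ _ _)

lemma smul_tmul (a : Γ(X, U)) (m : Γ(M, U)) (n : Γ(N, U)) : tmul (a • m) n = a • tmul m n :=
  (congrArg (tensorUnit M N U) (TensorProduct.smul_tmul' a m n).symm).trans (map_smul _ _ _)

lemma tmul_smul (a : Γ(X, U)) (m : Γ(M, U)) (n : Γ(N, U)) : tmul m (a • n) = a • tmul m n :=
  (congrArg (tensorUnit M N U) (TensorProduct.tmul_smul a m n)).trans (map_smul _ _ _)

lemma tmul_res (i : U ⟶ V) (m : Γ(M, V)) (n : Γ(N, V)) :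
    tmul (M.presheaf.map i.op m) (N.presheaf.map i.op n) =
      (tensor M N).presheaf.map i.op (tmul m n) :=
  PresheafOfModules.naturality_apply ((sheafifyAdj X).unit.app
    (PresheafOfModules.Monoidal.tensorObj (R := X.presheaf) M.val N.val)) i.op
    (TensorProduct.tmul Γ(X, V) m n)

lemma constToPresheaf_app (f : Y ⟶ X) (p : X ⟶ Spec k) (U : X.Opens) (c : k) :
    f.app U ((constToPresheaf p).app (.op U) c) =
      (constToPresheaf (f ≫ p)).app (.op (f ⁻¹ᵁ U)) c :=
  congr($(f.naturality (homOfLE (le_top : U ≤ ⊤)).op) (p.appTop ((Scheme.ΓSpecIso k).inv c)))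

end

/-- The morphism `M ⊗ N ⟶ K` given by bilinear maps `β U : Γ(M, U) × Γ(N, U) → Γ(K, U)` compatible
with restriction; it sends `m ⊗ n` to `β m n`. -/
def tensorLift {X : Scheme.{u}} {M N K : X.Modules}
    (β : ∀ U : X.Opens, Γ(M, U) → Γ(N, U) → Γ(K, U))
    (add_left : ∀ U m m' n, β U (m + m') n = β U m n + β U m' n)
    (smul_left : ∀ U (a : Γ(X, U)) m n, β U (a • m) n = a • β U m n)
    (add_right : ∀ U m n n', β U m (n + n') = β U m n + β U m n')
    (smul_right : ∀ U (a : Γ(X, U)) m n, β U m (a • n) = a • β U m n)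
    (res : ∀ (U V : X.Opens) (i : U ⟶ V) m n,
      β U (M.presheaf.map i.op m) (N.presheaf.map i.op n) = K.presheaf.map i.op (β V m n)) :
    tensor M N ⟶ K :=
  ((sheafifyAdj X).homEquiv _ K).symm
    { app U := ModuleCat.MonoidalCategory.tensorLift (R := Γ(X, U.unop))
        (M₁ := M.val.obj U) (M₂ := N.val.obj U) (M₃ := K.val.obj U) (β U.unop)
        (add_left U.unop) (smul_left U.unop) (add_right U.unop) (smul_right U.unop)
      naturality {U _} i := ModuleCat.MonoidalCategory.tensor_ext (R := Γ(X, U.unop))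
        (M₁ := M.val.obj U) (M₂ := N.val.obj U) (fun m n ↦ res _ _ i.unop m n) }

/-- The morphism `Ω¹_{X/k} ⟶ K` given by a `k`-derivation `δ` of `𝒪_X` with values in `K`; it sends
`d a` to `δ a`. -/
def cotangentDesc {X : Scheme.{u}} {k : CommRingCat.{u}} (p : X ⟶ Spec k) {K : X.Modules}
    (δ : ∀ U : X.Opens, Γ(X, U) → Γ(K, U))
    (add : ∀ U a b, δ U (a + b) = δ U a + δ U b)
    (mul : ∀ U (a b : Γ(X, U)), δ U (a * b) = a • δ U b + b • δ U a)
    (const : ∀ U (c : k), δ U ((constToPresheaf p).app (.op U) c) = 0)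
    (res : ∀ (U V : X.Opens) (i : U ⟶ V) a,
      δ U (X.presheaf.map i.op a) = K.presheaf.map i.op (δ V a)) :
    cotangent p ⟶ K :=
  ((sheafifyAdj X).homEquiv _ K).symm
    ((PresheafOfModules.DifferentialsConstruction.isUniversal' (constToPresheaf p)).desc
      (M' := K.val)
      { d {U} := AddMonoidHom.mk' (δ U.unop) (add U.unop)
        d_mul {U} a b := mul U.unop a b
        d_map i a := res _ _ i.unop a
        d_app {U} c := const U.unop c })

/-- Pullback of differential forms along `f : Y ⟶ X`, as a morphism
`Ω¹_{X/k} ⟶ f_* Ω¹_{Y/k}`, `d a ↦ d (f^* a)`. -/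
def cotangentMap {X Y : Scheme.{u}} {k : CommRingCat.{u}} (f : Y ⟶ X) (p : X ⟶ Spec k) :
    cotangent p ⟶ (Scheme.Modules.pushforward f).obj (cotangent (f ≫ p)) :=
  cotangentDesc p (fun U a ↦ dSec (f ≫ p) (f ⁻¹ᵁ U) (f.app U a))
    (fun U a b ↦ (congrArg (dSec (f ≫ p) (f ⁻¹ᵁ U)) (map_add (f.app U).hom a b)).trans
      (dSec_add _ _ _))
    (fun U a b ↦ (congrArg (dSec (f ≫ p) (f ⁻¹ᵁ U)) (map_mul (f.app U).hom a b)).trans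
      (dSec_mul _ _ _))
    (fun U c ↦ (congrArg (dSec (f ≫ p) (f ⁻¹ᵁ U)) (constToPresheaf_app f p U c)).trans
      (dSec_const _ _))
    (fun U V i a ↦ (congrArg (dSec (f ≫ p) (f ⁻¹ᵁ U)) congr($(f.naturality i.op) a)).trans
      (dSec_res (f ≫ p) ((TopologicalSpace.Opens.map f.base).map i) (f.app V a)))

/-- Given `a : M ⟶ f_* M'` and `b : N ⟶ f_* N'`, the morphism `M ⊗ N ⟶ f_* (M' ⊗ N')`,
`m ⊗ n ↦ a m ⊗ b n`. -/
def tensorPush {X Y : Scheme.{u}} (f : Y ⟶ X) {M N : X.Modules} {M' N' : Y.Modules}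
    (a : M ⟶ (Scheme.Modules.pushforward f).obj M')
    (b : N ⟶ (Scheme.Modules.pushforward f).obj N') :
    tensor M N ⟶ (Scheme.Modules.pushforward f).obj (tensor M' N') :=
  tensorLift (fun U m n ↦ tmul (U := f ⁻¹ᵁ U) (a.app U m) (b.app U n))
    (fun U m m' n ↦ by rw [map_add]; exact add_tmul _ _ _)
    (fun U r m n ↦ by rw [Scheme.Modules.Hom.app_smul]; exact smul_tmul _ _ _)
    (fun U m n n' ↦ by rw [map_add]; exact tmul_add _ _ _)
    (fun U r m n ↦ by rw [Scheme.Modules.Hom.app_smul]; exact tmul_smul _ _ _)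
    (fun U V i m n ↦ by
      have h1 := congr($(a.mapPresheaf.naturality i.op) m)
      have h2 := congr($(b.mapPresheaf.naturality i.op) n)
      refine Eq.trans (congrArg₂ tmul h1 h2) ?_
      exact tmul_res _ _ _)

/-! ### Vector bundles, Higgs bundles, Grassmann bundles -/

/-- The `𝒪_X`-module `M` is locally free of rank `r`. -/
def IsLocallyFreeOfRank {X : Scheme.{u}} (M : X.Modules) (r : ℕ) : Prop :=
  ∀ x : X, ∃ U : X.Opens, x ∈ U ∧
    Nonempty (M.restrict U.ι ≅
      SheafOfModules.free (R := (U : Scheme.{u}).ringCatSheaf) (ULift.{u} (Fin r)))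

/-- A rank `r` Higgs bundle `(E, φ)` on a smooth curve `p : X ⟶ Spec k`: a locally free sheaf `E` of
rank `r` with an `𝒪_X`-linear morphism `φ : E ⟶ E ⊗ Ω¹_X`. (The integrability condition
`φ ∧ φ = 0`, which takes place in `E ⊗ Ω²_X`, is void on a curve, as `Ω²_X = 0` there.) -/
structure HiggsBundleOnCurve {X : Scheme.{u}} {k : CommRingCat.{u}} (p : X ⟶ Spec k) (r : ℕ) where
  /-- the underlying vector bundle -/
  E : X.Modules
  locallyFree : IsLocallyFreeOfRank E r
  /-- the Higgs field -/
  φ : E ⟶ tensor E (cotangent p)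

/-- The Grassmann bundle `π : Gr_d(E) ⟶ X` of rank `d` locally free quotients of `E`, with its
universal quotient `q : π^* E ⟶ Q`. It is determined up to unique isomorphism by its defining
universal property: for each `f : T ⟶ X`, every rank `d` locally free quotient `f^* E ⟶ R` is, up to
isomorphism of quotients, the pullback of `q` along a unique morphism `g : T ⟶ Gr_d(E)` over `X`. -/
structure GrassmannBundle {X : Scheme.{u}} (E : X.Modules) (d : ℕ) where
  /-- the total space -/
  P : Scheme.{u}
  /-- the projection -/
  π : P ⟶ X
  /-- the universal quotient bundle -/
  Q : P.Modules
  /-- the universal quotient morphism -/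
  q : (Scheme.Modules.pullback π).obj E ⟶ Q
  epi_q : Epi q
  locallyFree_Q : IsLocallyFreeOfRank Q d
  existsUnique_hom : ∀ (T : Scheme.{u}) (f : T ⟶ X) (R : T.Modules)
    (r : (Scheme.Modules.pullback f).obj E ⟶ R), Epi r → IsLocallyFreeOfRank R d →
    ∃! g : T ⟶ P, ∃ (h : g ≫ π = f) (e : (Scheme.Modules.pullback g).obj Q ≅ R),
      (Scheme.Modules.pullback g).map q ≫ e.hom =
        (Scheme.Modules.pullbackComp g π).hom.app E ≫
          (Scheme.Modules.pullbackCongr h).hom.app E ≫ r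

/-! ### The Higgs Grassmannian -/

/-- For a Higgs field `φ : E ⟶ E ⊗ Ω¹_X` and `f : Y ⟶ X`, the Higgs field
`f^* E ⟶ f^* E ⊗ f^* Ω¹_X ⟶ f^* E ⊗ Ω¹_Y`, written as the adjoint of
`E ⟶ E ⊗ Ω¹_X ⟶ f_* (f^* E ⊗ Ω¹_Y)`, where the second map is `e ⊗ ω ↦ f^* e ⊗ f^* ω`. -/
def pullbackHiggsField {X Y : Scheme.{u}} {k : CommRingCat.{u}} (f : Y ⟶ X) (p : X ⟶ Spec k)
    {E : X.Modules} (φ : E ⟶ tensor E (cotangent p)) :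
    (Scheme.Modules.pullback f).obj E ⟶
      tensor ((Scheme.Modules.pullback f).obj E) (cotangent (f ≫ p)) :=
  ((Scheme.Modules.pullbackPushforwardAdjunction f).homEquiv _ _).symm
    (φ ≫ tensorPush f ((Scheme.Modules.pullbackPushforwardAdjunction f).unit.app E)
      (cotangentMap f p))

/-- The composition `S_d ⟶ π^* E ⟶ π^* E ⊗ Ω¹ ⟶ Q_d ⊗ Ω¹` on the Grassmann bundle `Gr_d(E)`, where
`S_d` is the kernel of `q : π^* E ⟶ Q_d`, the middle map is `π^* φ` and `Ω¹` is the cotangent sheaf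
of `Gr_d(E)` over `k`. -/
def higgsComposition {X : Scheme.{u}} {k : CommRingCat.{u}} (p : X ⟶ Spec k) {r d : ℕ}
    (F : HiggsBundleOnCurve p r) (G : GrassmannBundle F.E d) :
    kernel G.q ⟶ tensor G.Q (cotangent (G.π ≫ p)) :=
  kernel.ι G.q ≫ pullbackHiggsField G.π p F.φ ≫ tensorMap G.q (𝟙 _)

/-- The ideal sheaf of the zero locus of a morphism `u : M ⟶ N`, for `N` locally free of finite rank:
the smallest ideal sheaf such that `u` vanishes on the closed subscheme that it defines. -/
def zeroLocusIdeal {Y : Scheme.{u}} {M N : Y.Modules} (u : M ⟶ N) : Y.IdealSheafData :=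
  sInf {I | (Scheme.Modules.pullback I.subschemeι).map u = 0}

/-- The `d`-th Higgs Grassmannian `Gr_d(𝔈)` of a Higgs bundle `𝔈 = (E, φ)`: the closed subscheme of
`Gr_d(E)` defined by the zero locus of the composition
`S_d ⟶ π^* E ⟶ π^* E ⊗ Ω¹ ⟶ Q_d ⊗ Ω¹`. -/
def higgsGrassmannian {X : Scheme.{u}} {k : CommRingCat.{u}} (p : X ⟶ Spec k) {r d : ℕ}
    (F : HiggsBundleOnCurve p r) (G : GrassmannBundle F.E d) : Scheme.{u} :=
  (zeroLocusIdeal (higgsComposition p F G)).subscheme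

end HiggsGr

end

/-!
As the ground field is algebraically closed, `X` has a rational point `i`. Near it the cotangent
sheaf is generated by one form `ω`, so in a local basis `e` of `E` the Higgs field reads
`φ (e j) = e' j ⊗ ω`. A functional on the fibre of `E` at `i` is determined by its vector of values
on `e`; write `ρ_v` for the one with values `v`. An eigenvector `v` of the linear map
`v ↦ (ρ_v (e' j))_j` gives a rank one quotient `ρ_v` of the fibre with `ρ_v (e' j) = c • ρ_v (e j)`.
Let `g` be the corresponding rational point of the Grassmann bundle. The composition
`π^* E ⟶ π^* E ⊗ Ω¹ ⟶ Q ⊗ Ω¹` factors through `q` after pullback along `g`, hence vanishes on the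
kernel of `q`. As `g` is a closed immersion, it factors through the zero locus.
-/

noncomputable section

universe u

namespace HiggsGr

section Sections

variable {X Y Z : Scheme.{u}} {M N : X.Modules} {U V W : X.Opens}

lemma comp_app_apply {L : X.Modules} (α : M ⟶ N) (β : N ⟶ L) (s : Γ(M, U)) :
    (α ≫ β).app U s = β.app U (α.app U s) := rfl

/-- Restriction of sections to a smaller open subset. -/
abbrev res (h : U ≤ V) (s : Γ(M, V)) : Γ(M, U) :=
  M.presheaf.map (homOfLE h).op s

lemma app_res (α : M ⟶ N) (h : U ≤ V) (s : Γ(M, V)) : α.app U (res h s) = res h (α.app V s) :=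
  congr($(α.mapPresheaf.naturality (homOfLE h).op) s)

lemma res_self (s : Γ(M, U)) : res le_rfl s = s :=
  congr($(M.presheaf.map_id (.op U)) s)

lemma res_res (h : U ≤ V) (h' : V ≤ W) (s : Γ(M, W)) : res h (res h' s) = res (h.trans h') s :=
  congr($(M.presheaf.map_comp (homOfLE h').op (homOfLE h).op) s).symm

lemma res_add (h : U ≤ V) (s t : Γ(M, V)) : res h (s + t) = res h s + res h t :=
  map_add _ _ _

lemma res_smul (h : U ≤ V) (a : Γ(X, V)) (s : Γ(M, V)) :
    res h (a • s) = X.presheaf.map (homOfLE h).op a • res h s :=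
  M.map_smul _ _ _

lemma res_tmul (h : U ≤ V) (m : Γ(M, V)) (n : Γ(N, V)) :
    res h (tmul m n) = tmul (res h m) (res h n) :=
  (tmul_res _ m n).symm

/-- The pullback `f^* s` of a section `s` of `M`, a section of `f^* M`. -/
def pull (f : Y ⟶ X) (s : Γ(M, U)) : Γ((Scheme.Modules.pullback f).obj M, f ⁻¹ᵁ U) :=
  ((Scheme.Modules.pullbackPushforwardAdjunction f).unit.app M).app U s

lemma pull_res (f : Y ⟶ X) (h : U ≤ V) (s : Γ(M, V)) :
    pull f (res h s) = res (f.preimage_mono h) (pull f s) :=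
  app_res _ h s

lemma pull_add (f : Y ⟶ X) (s t : Γ(M, U)) : pull f (s + t) = pull f s + pull f t :=
  map_add _ _ _

lemma pull_smul (f : Y ⟶ X) (a : Γ(X, U)) (s : Γ(M, U)) :
    pull f (a • s) = f.app U a • pull f s :=
  Scheme.Modules.Hom.app_smul _ _ _

lemma pullback_map_app_pull (f : Y ⟶ X) (α : M ⟶ N) (s : Γ(M, U)) :
    ((Scheme.Modules.pullback f).map α).app (f ⁻¹ᵁ U) (pull f s) = pull f (α.app U s) :=
  congr(($((Scheme.Modules.pullbackPushforwardAdjunction f).unit.naturality α)).app U s).symm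

lemma homEquiv_app (f : Y ⟶ X) {N : Y.Modules} (α : (Scheme.Modules.pullback f).obj M ⟶ N)
    (s : Γ(M, U)) :
    ((Scheme.Modules.pullbackPushforwardAdjunction f).homEquiv M N α).app U s =
      α.app (f ⁻¹ᵁ U) (pull f s) := by
  rw [Adjunction.homEquiv_unit]; rfl

lemma homEquiv_symm_app_pull (f : Y ⟶ X) {N : Y.Modules}
    (α : M ⟶ (Scheme.Modules.pushforward f).obj N) (s : Γ(M, U)) :
    (((Scheme.Modules.pullbackPushforwardAdjunction f).homEquiv M N).symm α).app (f ⁻¹ᵁ U)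
      (pull f s) = α.app U s := by
  rw [← homEquiv_app, Equiv.apply_symm_apply]

lemma pullbackComp_hom_app_pull (f : Z ⟶ Y) (g : Y ⟶ X) (s : Γ(M, U)) :
    ((Scheme.Modules.pullbackComp f g).hom.app M).app ((f ≫ g) ⁻¹ᵁ U) (pull f (pull g s)) =
      pull (f ≫ g) s := by
  have unit_comp := unit_conjugateEquiv
    ((Scheme.Modules.pullbackPushforwardAdjunction g).comp
      (Scheme.Modules.pullbackPushforwardAdjunction f))
    (Scheme.Modules.pullbackPushforwardAdjunction (f ≫ g))
    (Scheme.Modules.pullbackComp f g).inv M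
  rw [Scheme.Modules.conjugateEquiv_pullbackComp_inv] at unit_comp
  have inv_app : pull f (pull g s) =
      ((Scheme.Modules.pullbackComp f g).inv.app M).app ((f ≫ g) ⁻¹ᵁ U) (pull (f ≫ g) s) :=
    congr(($unit_comp).app U s)
  rw [inv_app]
  exact congr(($((Scheme.Modules.pullbackComp f g).inv_hom_id_app M)).app _ (pull (f ≫ g) s))

end Sections

section GlobalBasis

variable {X Y : Scheme.{u}} {ι : Type*} {M N : X.Modules}

/-- The global sections `s j` form a basis of `M`, expressed by the universal property of a free
module: morphisms out of `M` correspond to arbitrary families of global sections. -/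
def IsGlobalBasis (s : ι → Γ(M, ⊤)) : Prop :=
  ∀ N : X.Modules, Function.Bijective fun (α : M ⟶ N) (j : ι) ↦ α.app ⊤ (s j)

namespace IsGlobalBasis

variable {s : ι → Γ(M, ⊤)} (hs : IsGlobalBasis s)

include hs

lemma hom_ext {α β : M ⟶ N} (h : ∀ j, α.app ⊤ (s j) = β.app ⊤ (s j)) : α = β :=
  (hs N).injective (funext h)

lemma map_iso (ε : M ≅ N) : IsGlobalBasis fun j ↦ ε.hom.app ⊤ (s j) := fun K ↦
  (hs K).comp (f := fun α ↦ ε.hom ≫ α) (ε.homFromEquiv.symm.bijective)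

lemma pull (f : Y ⟶ X) : IsGlobalBasis (X := Y) fun j ↦ HiggsGr.pull f (s j) := fun K ↦ by
  have := (hs ((Scheme.Modules.pushforward f).obj K)).comp
    ((Scheme.Modules.pullbackPushforwardAdjunction f).homEquiv M K).bijective
  simp only [Function.comp_def, homEquiv_app] at this
  exact this

end IsGlobalBasis

/-- The morphism `M ⟶ N` taking the members of a global basis of `M` to given sections. -/
def IsGlobalBasis.desc {s : ι → Γ(M, ⊤)} (hs : IsGlobalBasis s) (n : ι → Γ(N, ⊤)) : M ⟶ N :=
  (Equiv.ofBijective _ (hs N)).symm n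

lemma IsGlobalBasis.desc_app {s : ι → Γ(M, ⊤)} (hs : IsGlobalBasis s) (n : ι → Γ(N, ⊤)) (j : ι) :
    (hs.desc n).app ⊤ (s j) = n j :=
  congrFun (Equiv.ofBijective_apply_symm_apply _ (hs N) n) j

lemma IsGlobalBasis.epi {t : ι → Γ(N, ⊤)} (ht : IsGlobalBasis t) (α : M ⟶ N) (m : ι → Γ(M, ⊤))
    (hm : ∀ j, α.app ⊤ (m j) = t j) : Epi α :=
  epi_of_epi_fac (f := ht.desc m) (h := 𝟙 N) (ht.hom_ext fun j ↦ by
    rw [comp_app_apply, ht.desc_app]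
    exact hm j)

/-- Sections, in the sense of compatible families, are determined by their value on all of `X`. -/
def sectionsEquiv (M : X.Modules) : SheafOfModules.sections M ≃ Γ(M, ⊤) where
  toFun s := s.eval (.op ⊤)
  invFun m := PresheafOfModules.sectionsMk (fun _ ↦ M.presheaf.map (homOfLE le_top).op m)
    fun _ _ i ↦ res_res i.unop.le le_top m
  left_inv s := PresheafOfModules.sections_ext _ _ fun _ ↦ s.2 _
  right_inv m := res_self m

lemma isGlobalBasis_freeSection (I : Type u) : IsGlobalBasis (M := SheafOfModules.free
    (R := X.ringCatSheaf) I) fun j ↦ sectionsEquiv _ (SheafOfModules.freeSection j) := fun N ↦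
  ((SheafOfModules.freeHomEquiv N).trans (Equiv.piCongrRight fun _ ↦ sectionsEquiv N)).bijective

/-- The structure sheaf as a module over itself. -/
abbrev unitModule (X : Scheme.{u}) : X.Modules := SheafOfModules.unit X.ringCatSheaf

/-- The section `1` of the structure sheaf. -/
def oneSection (X : Scheme.{u}) : Γ(unitModule X, ⊤) := (1 : Γ(X, ⊤))

lemma isGlobalBasis_oneSection (X : Scheme.{u}) :
    IsGlobalBasis fun _ : Unit ↦ oneSection X := fun N ↦
  (((SheafOfModules.unitHomEquiv N).trans (sectionsEquiv N)).trans
    (Equiv.funUnique Unit _).symm).bijective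

lemma isLocallyFreeOfRank_unitModule (X : Scheme.{u}) : IsLocallyFreeOfRank (unitModule X) 1 := by
  intro x
  refine ⟨⊤, trivial, ⟨Scheme.Modules.restrictUnitIso _ ≪≫ ?_⟩⟩
  exact (coproductUniqueIso fun _ : ULift (Fin 1) ↦ unitModule (⊤ : X.Opens).toScheme).symm

lemma restrictFunctorIsoPullback_hom_app (f : Y ⟶ X) [IsOpenImmersion f] (V : Y.Opens)
    (s : Γ(M, f ''ᵁ V)) :
    ((Scheme.Modules.restrictFunctorIsoPullback f).hom.app M).app V s =
      res (f.preimage_image_eq V).ge (pull f s) := by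
  have unit_comp := Adjunction.unit_leftAdjointUniq_hom_app (Scheme.Modules.restrictAdjunction f)
    (Scheme.Modules.pullbackPushforwardAdjunction f) M
  have pull_eq : pull f s =
      ((Scheme.Modules.restrictFunctorIsoPullback f).hom.app M).app (f ⁻¹ᵁ f ''ᵁ V)
        (res (M := M) (f.image_preimage_le _) s) := congr(($unit_comp).app _ s).symm
  rw [pull_eq]
  exact (congrArg _ ((res_res (M := M) _ _ s).trans (res_self s)).symm).trans
    (app_res (M := M.restrict f) _ (f.preimage_image_eq V).ge _)

lemma IsLocallyFreeOfRank.exists_isGlobalBasis_pull {r : ℕ} (hM : IsLocallyFreeOfRank M r)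
    (x : X) :
    ∃ (U : X.Opens) (e : ULift.{u} (Fin r) → Γ(M, U)), x ∈ U ∧
      ∀ ⦃T : Scheme.{u}⦄ (i : T ⟶ X) (h : ⊤ ≤ i ⁻¹ᵁ U),
        IsGlobalBasis fun j ↦ res h (pull i (e j)) := by
  obtain ⟨U, hx, ⟨ε⟩⟩ := hM x
  let e j : Γ(M, U.ι ''ᵁ ⊤) := ε.inv.app ⊤ (sectionsEquiv _ (SheafOfModules.freeSection j))
  refine ⟨U.ι ''ᵁ ⊤, e, by simpa using hx, fun T i h ↦ ?_⟩
  obtain ⟨i, rfl⟩ : ∃ i' : T ⟶ U, i = i' ≫ U.ι :=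
    ⟨IsOpenImmersion.lift U.ι i (by
      rintro _ ⟨t, rfl⟩
      simpa using h (Set.mem_univ t)), (IsOpenImmersion.lift_fac _ _ _).symm⟩
  have basis_restrict : IsGlobalBasis (M := M.restrict U.ι) e :=
    (isGlobalBasis_freeSection _).map_iso ε.symm
  have basis_pull := ((basis_restrict.map_iso
    ((Scheme.Modules.restrictFunctorIsoPullback U.ι).app M)).pull i).map_iso
      ((Scheme.Modules.pullbackComp i U.ι).app M)
  have pull_comp (j) : res h (pull (i ≫ U.ι) (e j)) = _ :=
    congrArg (res h) (pullbackComp_hom_app_pull i U.ι (e j)).symm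
  simp only [Iso.app_hom, restrictFunctorIsoPullback_hom_app, pull_res] at basis_pull
  refine (congrArg IsGlobalBasis (funext fun j ↦ ?_)).mp basis_pull
  rw [pull_comp]
  exact app_res ((Scheme.Modules.pullbackComp i U.ι).hom.app M) _ _

end GlobalBasis

section Generators

variable {X Y : Scheme.{u}} {M M' N N' : X.Modules} {U V : X.Opens}

lemma exists_res_eq_sheafifyAdj_unit (F : X.PresheafOfModules) (s : Γ((sheafify X).obj F, U))
    {x : X} (hx : x ∈ U) :
    ∃ (V : X.Opens) (h : V ≤ U) (t : F.obj (.op V)), x ∈ V ∧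
      res h s = (((sheafifyAdj X).unit.app F).app (.op V)).hom t := by
  have locallySurjective : TopCat.Presheaf.IsLocallySurjective
      (CategoryTheory.toSheafify (Opens.grothendieckTopology X) F.presheaf) := by
    unfold TopCat.Presheaf.IsLocallySurjective
    infer_instance
  obtain ⟨V, i, ⟨t, ht⟩, hV⟩ :=
    (TopCat.Presheaf.isLocallySurjective_iff _).mp locallySurjective U s x hx
  exact ⟨V, i, t, hV, ht.symm⟩

lemma sheafifyAdj_homEquiv_symm_app_unit (F : X.PresheafOfModules) (K : X.Modules)
    (α : F ⟶ (Scheme.Modules.toPresheafOfModules X).obj K) (t : F.obj (.op U)) :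
    (((sheafifyAdj X).homEquiv F K).symm α).app U
      ((((sheafifyAdj X).unit.app F).app (.op U)).hom t) = (α.app (.op U)).hom t := by
  have unit_eq := (sheafifyAdj X).homEquiv_unit (f := ((sheafifyAdj X).homEquiv F K).symm α)
  rw [Equiv.apply_symm_apply] at unit_eq
  exact congr((($unit_eq).app (.op U)).hom t).symm

lemma tensorMap_app_tmul (f : M ⟶ M') (g : N ⟶ N') (m : Γ(M, U)) (n : Γ(N, U)) :
    (tensorMap f g).app U (tmul m n) = tmul (f.app U m) (g.app U n) :=
  congr((($((sheafifyAdj X).unit.naturality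
    (PresheafOfModules.Monoidal.tensorHom (R := X.presheaf) f.val g.val))).app (.op U)).hom
      (TensorProduct.tmul Γ(X, U) m n)).symm

lemma tensorPush_app_tmul (f : Y ⟶ X) {M' N' : Y.Modules}
    (a : M ⟶ (Scheme.Modules.pushforward f).obj M')
    (b : N ⟶ (Scheme.Modules.pushforward f).obj N') (m : Γ(M, U)) (n : Γ(N, U)) :
    (tensorPush f a b).app U (tmul m n) = tmul (U := f ⁻¹ᵁ U) (a.app U m) (b.app U n) :=
  sheafifyAdj_homEquiv_symm_app_unit
    (PresheafOfModules.Monoidal.tensorObj (R := X.presheaf) M.val N.val) _ _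
    (TensorProduct.tmul Γ(X, U) m n)

/-- The section `ω` of `N` generates the stalk of `N` at `x`: near `x`, every section of `N` is a
multiple of `ω`. -/
def GeneratesAt (ω : Γ(N, U)) (x : X) : Prop :=
  ∀ ⦃V : X.Opens⦄ (h : V ≤ U), x ∈ V → ∀ s : Γ(N, V),
    ∃ (W : X.Opens) (h' : W ≤ V) (a : Γ(X, W)), x ∈ W ∧ res h' s = a • res (h'.trans h) ω

lemma GeneratesAt.res {ω : Γ(N, U)} {x : X} (hω : GeneratesAt ω x) (h : V ≤ U) :
    GeneratesAt (HiggsGr.res h ω) x := fun W hW hx s ↦ by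
  obtain ⟨W', h', a, hx', ha⟩ := hω (hW.trans h) hx s
  exact ⟨W', h', a, hx', ha.trans (congrArg _ (res_res _ _ _).symm)⟩

lemma GeneratesAt.exists_res_eq_tmul {ω : Γ(N, U)} {x : X} (hω : GeneratesAt ω x) (hx : x ∈ U)
    (s : Γ(tensor M N, U)) :
    ∃ (V : X.Opens) (h : V ≤ U) (m : Γ(M, V)), x ∈ V ∧
      HiggsGr.res h s = tmul m (HiggsGr.res h ω) := by
  obtain ⟨V, hV, t, hxV, s_eq⟩ := exists_res_eq_sheafifyAdj_unit _ s hx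
  suffices tensorUnit_eq : ∀ t : TensorProduct Γ(X, V) Γ(M, V) Γ(N, V),
      ∃ (W : X.Opens) (h : W ≤ V) (m : Γ(M, W)), x ∈ W ∧
        HiggsGr.res h (tensorUnit M N V t) = tmul m (HiggsGr.res (h.trans hV) ω) by
    obtain ⟨W, h, m, hxW, t_eq⟩ := tensorUnit_eq t
    exact ⟨W, h.trans hV, m, hxW,
      (res_res h hV s).symm.trans ((congrArg (HiggsGr.res h) s_eq).trans t_eq)⟩
  intro t
  induction t using TensorProduct.induction_on with
  | zero =>
    refine ⟨V, le_rfl, 0, hxV, (congrArg _ (map_zero _)).trans ((map_zero _).trans ?_)⟩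
    rw [← zero_smul Γ(X, V) (0 : Γ(M, V)), smul_tmul, zero_smul]
  | tmul m n =>
    obtain ⟨W, h, a, hxW, n_eq⟩ := hω hV hxV n
    exact ⟨W, h, a • HiggsGr.res h m, hxW, (res_tmul h m n).trans
      ((congrArg (tmul _) n_eq).trans ((tmul_smul _ _ _).trans (smul_tmul _ _ _).symm))⟩
  | add t t' ih ih' =>
    obtain ⟨W, h, m, hxW, t_eq⟩ := ih
    obtain ⟨W', h', m', hxW', t'_eq⟩ := ih'
    have res_eq := congrArg (HiggsGr.res (inf_le_left : W ⊓ W' ≤ W)) t_eq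
    have res_eq' := congrArg (HiggsGr.res (inf_le_right : W ⊓ W' ≤ W')) t'_eq
    rw [res_res, res_tmul, res_res] at res_eq res_eq'
    refine ⟨W ⊓ W', inf_le_left.trans h,
      HiggsGr.res inf_le_left m + HiggsGr.res inf_le_right m', ⟨hxW, hxW'⟩, ?_⟩
    rw [map_add, add_tmul]
    exact (map_add _ _ _).trans (congrArg₂ (· + ·) res_eq res_eq')

lemma GeneratesAt.exists_forall_res_eq_tmul {ι : Type*} [Finite ι] {ω : Γ(N, U)} {x : X}
    (hω : GeneratesAt ω x) (hx : x ∈ U) (s : ι → Γ(tensor M N, U)) :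
    ∃ (V : X.Opens) (h : V ≤ U) (m : ι → Γ(M, V)), x ∈ V ∧
      ∀ j, HiggsGr.res h (s j) = tmul (m j) (HiggsGr.res h ω) := by
  have := Fintype.ofFinite ι
  choose V hV m hxV s_eq using fun j ↦ hω.exists_res_eq_tmul hx (s j)
  have inf_le (j) : U ⊓ Finset.univ.inf V ≤ V j := inf_le_right.trans (Finset.inf_le (by simp))
  refine ⟨U ⊓ Finset.univ.inf V, inf_le_left, fun j ↦ HiggsGr.res (inf_le j) (m j),
    ⟨hx, ?_⟩, fun j ↦ ?_⟩
  · exact Finset.inf_induction (p := fun V : X.Opens ↦ x ∈ V) trivial (fun _ h _ h' ↦ ⟨h, h'⟩)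
      fun j _ ↦ hxV j
  · have := congrArg (HiggsGr.res (inf_le j)) (s_eq j)
    rwa [res_res, res_tmul, res_res] at this

end Generators

section Cotangent

lemma span_singleton_kaehlerDifferential_map_eq_top {A B B' : CommRingCat.{u}} {f : A ⟶ B}
    {f' : A ⟶ B'} (g : B ⟶ B') (fac : 𝟙 A ≫ f' = f ≫ g) (S : Submonoid B)
    (hg : @IsLocalization B _ S B' _ g.hom.toAlgebra)
    {w : CommRingCat.KaehlerDifferential f} (hw : Submodule.span B {w} = ⊤) :
    Submodule.span B' {(show CommRingCat.KaehlerDifferential f' from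
      CommRingCat.KaehlerDifferential.map fac w)} = ⊤ := by
  algebraize [f.hom, f'.hom, g.hom]
  have := IsScalarTower.of_algebraMap_eq' (congrArg CommRingCat.Hom.hom fac)
  exact (Set.image_singleton ▸ span_eq_top_of_isLocalizedModule B' S
    (KaehlerDifferential.map A A B B') (v := {w}) hw :)

variable {X : Scheme.{u}} {k : CommRingCat.{u}} (p : X ⟶ Spec k)

lemma cotangentUnit_map {U V : X.Opens} (h : U ≤ V)
    (t : CommRingCat.KaehlerDifferential ((constToPresheaf p).app (.op V))) :
    cotangentUnit p U (((cotangentPresheaf p).map (homOfLE h).op).hom t) =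
      res h (cotangentUnit p V t) :=
  PresheafOfModules.naturality_apply ((sheafifyAdj X).unit.app (cotangentPresheaf p))
    (homOfLE h).op t

lemma generatesAt_cotangentUnit {V : X.Opens} (hV : IsAffineOpen V) {x : X} (hx : x ∈ V)
    {w : CommRingCat.KaehlerDifferential ((constToPresheaf p).app (.op V))}
    (hw : Submodule.span Γ(X, V) {w} = ⊤) : GeneratesAt (cotangentUnit p V w) x := by
  intro U hU hxU s
  obtain ⟨U', hU', t, hxU', s_eq⟩ := exists_res_eq_sheafifyAdj_unit _ s hxU
  obtain ⟨f, hf, hxf⟩ := hV.exists_basicOpen_le (V := U') ⟨x, hxU'⟩ hx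
  have hfV : X.basicOpen f ≤ V := X.basicOpen_le f
  have span_eq := span_singleton_kaehlerDifferential_map_eq_top
    (X.presheaf.map (homOfLE hfV).op) ((constToPresheaf p).naturality (homOfLE hfV).op)
    (.powers f) (hV.isLocalization_basicOpen f) hw
  let dRes {W W' : X.Opens} (h : W ≤ W') :
      CommRingCat.KaehlerDifferential ((constToPresheaf p).app (.op W')) →
        CommRingCat.KaehlerDifferential ((constToPresheaf p).app (.op W)) :=
    ((cotangentPresheaf p).map (homOfLE h).op).hom
  obtain ⟨a, ha⟩ := Submodule.mem_span_singleton.mp (span_eq ▸ Submodule.mem_top (x := dRes hf t))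
  refine ⟨X.basicOpen f, hf.trans hU', a, hxf, ?_⟩
  calc res (hf.trans hU') s = res hf (cotangentUnit p U' t) :=
        (res_res _ _ _).symm.trans (congrArg _ s_eq)
    _ = cotangentUnit p _ (dRes hf t) := (cotangentUnit_map p hf t).symm
    _ = a • cotangentUnit p _ (dRes hfV w) := (congrArg _ ha.symm).trans (map_smul _ _ _)
    _ = a • res hfV (cotangentUnit p V w) := congrArg _ (cotangentUnit_map p hfV w)

lemma exists_span_singleton_kaehlerDifferential_eq_top {A B : CommRingCat.{u}} [Nontrivial B]
    {f : A ⟶ B} (hf : f.hom.IsStandardSmoothOfRelativeDimension 1) :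
    ∃ w : CommRingCat.KaehlerDifferential f, Submodule.span B {w} = ⊤ := by
  algebraize [f.hom]
  have isStandardSmooth :=
    Algebra.IsStandardSmoothOfRelativeDimension.isStandardSmooth (R := A) (S := B) 1
  have rank_eq :=
    Algebra.IsStandardSmoothOfRelativeDimension.rank_kaehlerDifferential (R := A) (S := B) 1
  obtain ⟨w, -, hw⟩ := rank_eq_one_iff.mp (rank_eq.trans Nat.cast_one)
  exact ⟨w, top_unique fun v _ ↦ Submodule.mem_span_singleton.mpr (hw v)⟩

lemma exists_generatesAt_cotangent {K : Type u} [Field K] (p : X ⟶ Spec (.of K))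
    [SmoothOfRelativeDimension 1 p] (x : X) :
    ∃ (V : X.Opens) (ω : Γ(cotangent p, V)), x ∈ V ∧ GeneratesAt ω x := by
  obtain ⟨U, hU, V, hV, hx, e, hf⟩ :=
    SmoothOfRelativeDimension.exists_isStandardSmoothOfRelativeDimension (n := 1) (f := p) x
  obtain rfl : U = ⊤ := by
    ext y
    simpa [Subsingleton.elim y (p x)] using e hx
  have : Nonempty V := ⟨⟨x, hx⟩⟩
  have isStandardSmooth :
      ((constToPresheaf p).app (.op V)).hom.IsStandardSmoothOfRelativeDimension 1 :=
    RingHom.isStandardSmoothOfRelativeDimension_respectsIso.right _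
      (Scheme.ΓSpecIso (.of K)).symm.commRingCatIsoToRingEquiv hf
  obtain ⟨w, hw⟩ := exists_span_singleton_kaehlerDifferential_eq_top isStandardSmooth
  exact ⟨V, cotangentUnit p V w, hx, generatesAt_cotangentUnit p hV hx hw⟩

end Cotangent

section PullbackTensor

variable {X T : Scheme.{u}} (f : T ⟶ X) {M N : X.Modules} {U V W : X.Opens}

lemma preimage_le_preimage_inf (hW : ⊤ ≤ f ⁻¹ᵁ W) (U : X.Opens) : f ⁻¹ᵁ U ≤ f ⁻¹ᵁ (U ⊓ W) :=
  le_inf le_rfl (le_top.trans hW)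

/-- For a section `ω` of `N` over a neighbourhood `W` of the image of `f`, the section `f^* (m ⊗ ω)`
over `f⁻¹ U`, where `m` is a section of `M` over an open subset `U` that need not lie in `W`. -/
def pullTmulSection (hW : ⊤ ≤ f ⁻¹ᵁ W) (ω : Γ(N, W)) (m : Γ(M, U)) :
    Γ((Scheme.Modules.pullback f).obj (tensor M N), f ⁻¹ᵁ U) :=
  res (preimage_le_preimage_inf f hW U) (pull f (tmul (res inf_le_left m) (res inf_le_right ω)))

lemma pullTmulSection_add (hW : ⊤ ≤ f ⁻¹ᵁ W) (ω : Γ(N, W)) (m m' : Γ(M, U)) :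
    pullTmulSection f hW ω (m + m') = pullTmulSection f hW ω m + pullTmulSection f hW ω m' := by
  unfold pullTmulSection
  rw [res_add, add_tmul, pull_add, res_add]

lemma pullTmulSection_smul (hW : ⊤ ≤ f ⁻¹ᵁ W) (ω : Γ(N, W)) (a : Γ(X, U)) (m : Γ(M, U)) :
    pullTmulSection f hW ω (a • m) = f.app U a • pullTmulSection f hW ω m := by
  have app_eq : T.presheaf.map (homOfLE (preimage_le_preimage_inf f hW U)).op
      (f.app (U ⊓ W) (X.presheaf.map (homOfLE inf_le_left).op a)) = f.app U a := by
    have naturality := congr($(f.naturality (homOfLE (inf_le_left : U ⊓ W ≤ U)).op) a)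
    refine (congrArg _ naturality).trans ?_
    exact congr($((T.presheaf.map_comp _ _).symm.trans (T.presheaf.map_id _)) (f.app U a))
  unfold pullTmulSection
  rw [res_smul, smul_tmul, pull_smul, res_smul, app_eq]

lemma pullTmulSection_res (hW : ⊤ ≤ f ⁻¹ᵁ W) (ω : Γ(N, W)) (h : U ≤ V) (m : Γ(M, V)) :
    pullTmulSection f hW ω (res h m) =
      res (f.preimage_mono h) (pullTmulSection f hW ω m) := by
  have tmul_eq : tmul (res inf_le_left (res h m)) (res inf_le_right ω) =
      res (inf_le_inf_right W h) (tmul (res inf_le_left m) (res inf_le_right ω)) := by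
    rw [res_tmul, res_res, res_res, res_res]
  unfold pullTmulSection
  rw [tmul_eq, pull_res, res_res, res_res]

/-- For a section `ω` of `N` over a neighbourhood of the image of `f`, the morphism
`f^* M ⟶ f^* (M ⊗ N)`, `f^* m ↦ f^* (m ⊗ ω)`. -/
def pullTmul (hW : ⊤ ≤ f ⁻¹ᵁ W) (ω : Γ(N, W)) :
    (Scheme.Modules.pullback f).obj M ⟶ (Scheme.Modules.pullback f).obj (tensor M N) :=
  ((Scheme.Modules.pullbackPushforwardAdjunction f).homEquiv _ _).symm
    { val :=
        { app V := ModuleCat.ofHom (R := Γ(X, V.unop)) (X := Γ(M, V.unop))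
            (Y := Γ((Scheme.Modules.pushforward f).obj
              ((Scheme.Modules.pullback f).obj (tensor M N)), V.unop))
            { toFun := pullTmulSection f hW ω
              map_add' := pullTmulSection_add f hW ω
              map_smul' := pullTmulSection_smul f hW ω }
          naturality i := by
            ext m
            exact pullTmulSection_res f hW ω i.unop.le m } }

lemma pullTmul_app_pull (hW : ⊤ ≤ f ⁻¹ᵁ W) (ω : Γ(N, W)) (m : Γ(M, W)) :
    (pullTmul f hW ω).app (f ⁻¹ᵁ W) (pull f m) = pull f (tmul m ω) := by
  refine (homEquiv_symm_app_pull f _ m).trans ?_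
  change pullTmulSection f hW ω m = _
  unfold pullTmulSection
  rw [← res_tmul, pull_res, res_res]
  exact res_self _

end PullbackTensor

section Higgs

variable {X Y T : Scheme.{u}} {k : CommRingCat.{u}} (p : X ⟶ Spec k) {E : X.Modules}
  (φ : E ⟶ tensor E (cotangent p)) {U : X.Opens}

lemma pullbackHiggsField_app_pull (f : Y ⟶ X) {e e' : Γ(E, U)} {ω : Γ(cotangent p, U)}
    (he : φ.app U e = tmul e' ω) :
    (pullbackHiggsField f p φ).app (f ⁻¹ᵁ U) (pull f e) =
      tmul (U := f ⁻¹ᵁ U) (pull f e') ((cotangentMap f p).app U ω) := by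
  refine (homEquiv_symm_app_pull f (φ ≫ tensorPush f _ _) e).trans ?_
  rw [comp_app_apply, he, tensorPush_app_tmul]
  rfl

/-- With `φ` written as `e j ↦ e' j ⊗ ω`, the hypothesis on `χ` says that the kernel of `g^* q` is
preserved by the Higgs field. -/
lemma pullback_map_pullbackHiggsField_comp_eq {ι : Type*} (π : Y ⟶ X) {Q : Y.Modules}
    (q : (Scheme.Modules.pullback π).obj E ⟶ Q) (g : T ⟶ Y) (hU : ⊤ ≤ g ⁻¹ᵁ π ⁻¹ᵁ U)
    {e e' : ι → Γ(E, U)} (basis : IsGlobalBasis fun j ↦ res hU (pull g (pull π (e j))))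
    {ω : Γ(cotangent p, U)} (he : ∀ j, φ.app U (e j) = tmul (e' j) ω)
    (χ : (Scheme.Modules.pullback g).obj Q ⟶ (Scheme.Modules.pullback g).obj Q)
    (hχ : ∀ j, χ.app ⊤ (res hU (pull g (q.app _ (pull π (e j))))) =
      res hU (pull g (q.app _ (pull π (e' j))))) :
    (Scheme.Modules.pullback g).map (pullbackHiggsField π p φ ≫ tensorMap q (𝟙 _)) =
      (Scheme.Modules.pullback g).map q ≫ χ ≫ pullTmul g hU ((cotangentMap π p).app U ω) := by
  refine basis.hom_ext fun j ↦ ?_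
  have higgs_eq : (pullbackHiggsField π p φ ≫ tensorMap q (𝟙 _)).app (π ⁻¹ᵁ U) (pull π (e j)) =
      tmul (U := π ⁻¹ᵁ U) (q.app _ (pull π (e' j))) ((cotangentMap π p).app U ω) := by
    rw [comp_app_apply, pullbackHiggsField_app_pull p φ π (he j)]
    exact tensorMap_app_tmul q (𝟙 _) (pull π (e' j)) ((cotangentMap π p).app U ω)
  rw [app_res, pullback_map_app_pull, higgs_eq, comp_app_apply, app_res, pullback_map_app_pull,
    comp_app_apply, hχ, app_res]
  exact congrArg (res hU) (pullTmul_app_pull g hU _ (q.app _ (pull π (e' j)))).symm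

end Higgs

section Eigenquotient

variable {X : Scheme.{u}} {ι : Type*} {M N : X.Modules} {s : ι → Γ(M, ⊤)}

lemma exists_eigenvector_of_ringEquiv {K B : Type u} {V : Type*} [Field K] [IsAlgClosed K]
    [CommRing B] [AddCommGroup V] [Module B V] [Module.Finite B V] [Nontrivial V] (σ : K ≃+* B)
    (L : Module.End B V) : ∃ (c : B) (v : V), v ≠ 0 ∧ L v = c • v := by
  let : Field B := (σ.symm.isField (Field.toIsField K)).toField
  have : IsAlgClosed B := .of_ringEquiv K B σ
  obtain ⟨c, hc⟩ := Module.End.exists_eigenvalue L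
  obtain ⟨v, hv⟩ := hc.exists_hasEigenvector
  exact ⟨c, v, hv.2, hv.apply_eq_smul⟩

/-- Multiplication by a global function, as an endomorphism of `M`. -/
def homothety (M : X.Modules) (a : Γ(X, ⊤)) : M ⟶ M where
  val :=
    { app U := ModuleCat.ofHom (R := Γ(X, U.unop)) (X := Γ(M, U.unop)) (Y := Γ(M, U.unop))
        (LinearMap.lsmul Γ(X, U.unop) Γ(M, U.unop) (X.presheaf.map (homOfLE le_top).op a))
      naturality {U V} i := by
        ext m
        have map_a : X.presheaf.map (homOfLE le_top).op a =
            X.presheaf.map i (X.presheaf.map (homOfLE le_top).op a) :=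
          congr($(X.presheaf.map_comp (homOfLE le_top).op i) a)
        exact (congrArg (fun b : Γ(X, V.unop) ↦ b • (res i.unop.le m : Γ(M, V.unop))) map_a).trans
          (M.map_smul i.unop _ m).symm }

lemma homothety_app_top (a : Γ(X, ⊤)) (m : Γ(M, ⊤)) : (homothety M a).app ⊤ m = a • m :=
  congr($(X.presheaf.map_id _) a • m)

/-- The map `n ↦ α m`, where `α : M ⟶ N` is the morphism with values `n` on a global basis of
`M`. -/
def IsGlobalBasis.evalDesc (hs : IsGlobalBasis s) (N : X.Modules) (m : Γ(M, ⊤)) :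
    (ι → Γ(N, ⊤)) →ₗ[Γ(X, ⊤)] Γ(N, ⊤) where
  toFun n := (hs.desc n).app ⊤ m
  map_add' n n' := by
    have desc_add : hs.desc (n + n') = hs.desc n + hs.desc n' := hs.hom_ext fun j ↦ by
      rw [Scheme.Modules.Hom.add_app, desc_app]
      exact congrArg₂ (· + ·) (hs.desc_app n j).symm (hs.desc_app n' j).symm
    rw [desc_add]
    rfl
  map_smul' a n := by
    have desc_smul : hs.desc (a • n) = hs.desc n ≫ homothety N a := hs.hom_ext fun j ↦ by
      rw [comp_app_apply, desc_app, desc_app, homothety_app_top]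
      rfl
    rw [desc_smul, comp_app_apply, homothety_app_top]
    rfl

lemma IsGlobalBasis.exists_epi_unitModule {K : Type u} [Field K] [IsAlgClosed K]
    (σ : K ≃+* Γ(X, ⊤)) [Finite ι] [Nonempty ι] (hs : IsGlobalBasis s) (s' : ι → Γ(M, ⊤)) :
    ∃ (ρ : M ⟶ unitModule X) (χ : unitModule X ⟶ unitModule X), Epi ρ ∧
      ∀ j, χ.app ⊤ (ρ.app ⊤ (s j)) = ρ.app ⊤ (s' j) := by
  have isField : IsField Γ(X, ⊤) := σ.symm.isField (Field.toIsField K)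
  have : Nontrivial Γ(unitModule X, ⊤) := isField.nontrivial
  have : Module.Finite Γ(X, ⊤) Γ(unitModule X, ⊤) := inferInstanceAs (Module.Finite Γ(X, ⊤) Γ(X, ⊤))
  obtain ⟨c, v, hv, eigen⟩ := exists_eigenvector_of_ringEquiv σ
    (LinearMap.pi fun j ↦ hs.evalDesc (unitModule X) (s' j))
  obtain ⟨j, hj⟩ := Function.ne_iff.mp hv
  obtain ⟨a, ha⟩ : ∃ a : Γ(X, ⊤), a • v j = oneSection X :=
    (isField.mul_inv_cancel hj).imp fun a ha ↦ (mul_comm _ _).trans ha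
  refine ⟨hs.desc v, homothety _ c, ?_, fun j ↦ ?_⟩
  · refine (isGlobalBasis_oneSection X).epi _ (fun _ ↦ a • s j) fun _ ↦ ?_
    rw [Scheme.Modules.Hom.app_smul, hs.desc_app, ha]
  · rw [hs.desc_app, homothety_app_top]
    exact (congrFun eigen j).symm

end Eigenquotient

section Points

variable {X : Scheme.{u}} {k : CommRingCat.{u}} {p : X ⟶ Spec k} {r : ℕ}

lemma HiggsBundleOnCurve.exists_local_form {K : Type u} [Field K] {p : X ⟶ Spec (.of K)}
    [SmoothOfRelativeDimension 1 p] (F : HiggsBundleOnCurve p r) (x : X) :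
    ∃ (U : X.Opens) (e e' : ULift.{u} (Fin r) → Γ(F.E, U)) (ω : Γ(cotangent p, U)), x ∈ U ∧
      (∀ ⦃T : Scheme.{u}⦄ (i : T ⟶ X) (h : ⊤ ≤ i ⁻¹ᵁ U),
        IsGlobalBasis fun j ↦ res h (pull i (e j))) ∧
      ∀ j, F.φ.app U (e j) = tmul (e' j) ω := by
  obtain ⟨U, e, hxU, basis⟩ := F.locallyFree.exists_isGlobalBasis_pull x
  obtain ⟨V, ω, hxV, generates⟩ := exists_generatesAt_cotangent p x
  obtain ⟨W, hWV, e', hxW, φ_eq⟩ :=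
    (generates.res (inf_le_right : U ⊓ V ≤ V)).exists_forall_res_eq_tmul ⟨hxU, hxV⟩
      fun j ↦ F.φ.app (U ⊓ V) (res inf_le_left (e j))
  refine ⟨W, fun j ↦ res (hWV.trans inf_le_left) (e j), e', res hWV (res inf_le_right ω), hxW,
    fun T i h ↦ ?_, fun j ↦ ?_⟩
  · refine (congrArg IsGlobalBasis (funext fun j ↦ ?_)).mp
      (basis i (h.trans (i.preimage_mono (hWV.trans inf_le_left))))
    rw [pull_res, res_res]
  · rw [← φ_eq, ← app_res, res_res]

lemma GrassmannBundle.exists_pullback_map_higgsComposition_eq_zero {d : ℕ}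
    (F : HiggsBundleOnCurve p r) (G : GrassmannBundle F.E d) {T : Scheme.{u}} (i : T ⟶ X)
    {U : X.Opens} (hU : ⊤ ≤ i ⁻¹ᵁ U) {ι : Type*} {e e' : ι → Γ(F.E, U)}
    (basis : IsGlobalBasis fun j ↦ res hU (pull i (e j))) {ω : Γ(cotangent p, U)}
    (he : ∀ j, F.φ.app U (e j) = tmul (e' j) ω) {R : T.Modules} (hR : IsLocallyFreeOfRank R d)
    (ρ : (Scheme.Modules.pullback i).obj F.E ⟶ R) [Epi ρ] (χ : R ⟶ R)
    (hχ : ∀ j, χ.app ⊤ (ρ.app ⊤ (res hU (pull i (e j)))) =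
      ρ.app ⊤ (res hU (pull i (e' j)))) :
    ∃ g : T ⟶ G.P, g ≫ G.π = i ∧
      (Scheme.Modules.pullback g).map (higgsComposition p F G) = 0 := by
  obtain ⟨g, ⟨rfl, ε, hε⟩, -⟩ := G.existsUnique_hom T i R ρ inferInstance hR
  have hU' : ⊤ ≤ g ⁻¹ᵁ G.π ⁻¹ᵁ U := hU
  have comp_hom (s : Γ(F.E, U)) : ((Scheme.Modules.pullbackComp g G.π).hom.app F.E).app ⊤
      (res hU' (pull g (pull G.π s))) = res hU (pull (g ≫ G.π) s) :=
    (app_res _ hU' _).trans (congrArg (res hU) (pullbackComp_hom_app_pull g G.π s))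
  have comp_inv (s : Γ(F.E, U)) : ((Scheme.Modules.pullbackComp g G.π).inv.app F.E).app ⊤
      (res hU (pull (g ≫ G.π) s)) = res hU' (pull g (pull G.π s)) := by
    rw [← comp_hom]
    exact congr(($((Scheme.Modules.pullbackComp g G.π).hom_inv_id_app F.E)).app ⊤ _)
  have basis' : IsGlobalBasis fun j ↦ res hU' (pull g (pull G.π (e j))) :=
    (congrArg IsGlobalBasis (funext fun j ↦ comp_inv (e j))).mp
      (basis.map_iso ((Scheme.Modules.pullbackComp g G.π).symm.app F.E))
  have ε_eq (s : Γ(F.E, U)) : ε.hom.app ⊤ (res hU' (pull g (G.q.app _ (pull G.π s)))) =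
      ρ.app ⊤ (res hU (pull (g ≫ G.π) s)) := by
    rw [← comp_hom, ← pullback_map_app_pull, ← app_res, ← comp_app_apply, hε]
    rfl
  have factors := pullback_map_pullbackHiggsField_comp_eq p F.φ G.π G.q g hU' basis' he
    (ε.hom ≫ χ ≫ ε.inv) fun j ↦ by
      rw [comp_app_apply, comp_app_apply, ε_eq, hχ, ← ε_eq]
      exact congr(($(ε.hom_inv_id)).app ⊤ _)
  refine ⟨g, rfl, ?_⟩
  rw [higgsComposition, Functor.map_comp, factors, ← Category.assoc, ← Functor.map_comp,
    kernel.condition, Functor.map_zero, zero_comp]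

lemma exists_section_of_isAlgClosed {K : Type u} [Field K] [IsAlgClosed K] (p : X ⟶ Spec (.of K))
    [LocallyOfFiniteType p] [Nonempty X] : ∃ i : Spec (.of K) ⟶ X, i ≫ p = 𝟙 _ := by
  have : JacobsonSpace X := LocallyOfFiniteType.jacobsonSpace p
  obtain ⟨x, -, hx⟩ : ((Set.univ : Set X) ∩ closedPoints X).Nonempty :=
    nonempty_inter_closedPoints Set.univ_nonempty isOpen_univ.isLocallyClosed
  exact ⟨pointOfClosedPoint p x hx, pointOfClosedPoint_comp p x hx⟩

lemma exists_point_pullback_map_higgsComposition_eq_zero {K : Type u} [Field K] [IsAlgClosed K]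
    {p : X ⟶ Spec (.of K)} [SmoothOfRelativeDimension 1 p] [NeZero r]
    (F : HiggsBundleOnCurve p r) (G : GrassmannBundle F.E 1) (i : Spec (.of K) ⟶ X) :
    ∃ g : Spec (.of K) ⟶ G.P, g ≫ G.π = i ∧
      (Scheme.Modules.pullback g).map (higgsComposition p F G) = 0 := by
  obtain ⟨U, e, e', ω, hxU, basis, he⟩ := F.exists_local_form (i (IsLocalRing.closedPoint K))
  have hU : ⊤ ≤ i ⁻¹ᵁ U := fun t _ ↦ Subsingleton.elim (IsLocalRing.closedPoint K) t ▸ hxU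
  obtain ⟨ρ, χ, _, hχ⟩ := (basis i hU).exists_epi_unitModule
    (Scheme.ΓSpecIso (.of K)).symm.commRingCatIsoToRingEquiv fun j ↦ res hU (pull i (e' j))
  exact G.exists_pullback_map_higgsComposition_eq_zero F i hU (basis i hU) he
    (isLocallyFreeOfRank_unitModule _) ρ χ hχ

end Points

section ZeroLocus

variable {Y T : Scheme.{u}} {M N : Y.Modules} {u : M ⟶ N}

lemma pullback_comp_map_eq_zero {Z : Scheme.{u}} (h : Z ⟶ T) {g : T ⟶ Y}
    (hu : (Scheme.Modules.pullback g).map u = 0) :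
    (Scheme.Modules.pullback (h ≫ g)).map u = 0 := by
  have naturality := (Scheme.Modules.pullbackComp h g).inv.naturality u
  rw [Functor.comp_map, hu, Functor.map_zero, comp_zero] at naturality
  rwa [← cancel_mono ((Scheme.Modules.pullbackComp h g).inv.app N), zero_comp]

lemma nonempty_subscheme_zeroLocusIdeal [Nonempty T] (g : T ⟶ Y) [IsClosedImmersion g]
    (hu : (Scheme.Modules.pullback g).map u = 0) : Nonempty (zeroLocusIdeal u).subscheme := by
  have subschemeι_eq : inv g.toImage ≫ g = g.ker.subschemeι := by
    rw [IsIso.inv_comp_eq]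
    exact g.toImage_imageι.symm
  have vanishes : (Scheme.Modules.pullback g.ker.subschemeι).map u = 0 :=
    subschemeι_eq ▸ pullback_comp_map_eq_zero (inv g.toImage) hu
  have le_ker : zeroLocusIdeal u ≤ g.ker := sInf_le vanishes
  exact ⟨Scheme.IdealSheafData.inclusion le_ker (g.toImage (Classical.arbitrary T))⟩

end ZeroLocus

end HiggsGr

theorem mainTheorem4_general {K : Type u} [Field K] [IsAlgClosed K] {X : Scheme.{u}}
    (p : X ⟶ Spec (.of K)) [SmoothOfRelativeDimension 1 p] [Nonempty X] {r : ℕ} [NeZero r]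
    (F : HiggsGr.HiggsBundleOnCurve p r) (G : HiggsGr.GrassmannBundle F.E 1) :
    Nonempty (HiggsGr.higgsGrassmannian p F G) := by
  have := SmoothOfRelativeDimension.smooth 1 p
  obtain ⟨i, hi⟩ := HiggsGr.exists_section_of_isAlgClosed p
  obtain ⟨g, rfl, hg⟩ := HiggsGr.exists_point_pullback_map_higgsComposition_eq_zero F G i
  have : IsClosedImmersion g := isClosedImmersion_of_comp_eq_id (G.π ≫ p) g (by simpa using hi)
  have : Nonempty (Spec (.of K)) := ⟨IsLocalRing.closedPoint K⟩
  exact HiggsGr.nonempty_subscheme_zeroLocusIdeal g hg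

end

theorem mainTheorem4 (X : Scheme.{0}) (p : X ⟶ Spec (CommRingCat.of ℂ))
    [SmoothOfRelativeDimension 1 p] [IsSeparated p] [QuasiCompact p] [ConnectedSpace X]
    (F : HiggsGr.HiggsBundleOnCurve p 2) (G : HiggsGr.GrassmannBundle F.E 1) :
    Nonempty (HiggsGr.higgsGrassmannian p F G) :=
  mainTheorem4_general p F G
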